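/- All graphs are finite and simple. For positive integers $n,k$, an $(n,k)$-graph is a graph whose vertex set is partitioned into $n$ parts, each of size at most $k$, such that no edge lies inside a part and there is exactly one edge between any two distinct parts. For a graph $H$ with maximum degree at least $2$, let $f(n,H)$ be the least positive integer $k$ such that there is an $(n,k)$-graph that does not contain $H$ as a (not necessarily induced) subgraph, and let $\mathrm{ex}(\ell,H)$ be the largest number of edges in an $\ell$-vertex graph that does not contain $H$ as a subgraph. Let $H$ be a bipartite graph with maximum degree at least $2$, and let $r$ be a real number such that $\mathrm{ex}(\ell,H)=\Theta(\ell^r)$ as $\ell\to\infty$. Then there are positive constants $C',C$ (depending only on $H$ and $r$) such that for every integer $n\ge 2$, $$C'\,n^{2/r-1}\;\le\; f(n,H)\;\le\; C\,n^{2/r-1}(\log n)^{1/r}.$$ -/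

import Mathlib

namespace SplitGraph

/-- `G` is an `(n, k)`-graph: its vertex set is partitioned into `n` blobs (the fibres of `b`), each
of size at most `k`, no edge lies inside a blob, and there is exactly one edge between any two
distinct blobs. -/
def IsNKGraph {V : Type} [Fintype V] (G : SimpleGraph V) (n k : ℕ) : Prop :=
  ∃ b : V → Fin n,
    (∀ i, (Finset.univ.filter fun v => b v = i).card ≤ k) ∧
    (∀ u v, G.Adj u v → b u ≠ b v) ∧
    ∀ i j, i ≠ j → ∃! e : V × V, b e.1 = i ∧ b e.2 = j ∧ G.Adj e.1 e.2

/-- The least positive integer `k` such that some `(n, k)`-graph contains no copy of `H` as a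
(not necessarily induced) subgraph. -/
noncomputable def f {W : Type*} (n : ℕ) (H : SimpleGraph W) : ℕ :=
  sInf {k : ℕ | 0 < k ∧
    ∃ (V : Type) (_ : Fintype V) (G : SimpleGraph V), IsNKGraph G n k ∧ H.Free G}

end SplitGraph

/-!
The lower bound is a count: an `H`-free `(n, k)`-graph has `n (n - 1) / 2` edges on at most `n k`
vertices, so `n (n - 1) / 2 ≤ ex(n k, H) = O((n k) ^ r)`.

For the upper bound, start from an extremal `H`-free graph on a grid with rows of length `n`, and
pass to a cut `(A, B)` with at least half of its edges. When `r > 1`, small vertex sets meet few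
edges, so one can greedily choose disjoint small cores `P₁, …, Pₙ ⊆ A`, each with about
`3 n log n` neighbours in `B`. Colour each row by a random cyclic shift of the `n` colours: by a
union bound some colouring shows every core all colours. Adding to `Pᵢ` the vertices of `B` of
colour `i`, at most one per row, gives `n` disjoint blobs with an edge between any two of them, and
surplus edges are deleted. Since `H` is bipartite, `ex(ℓ, H) = o(ℓ ^ 2)`, so `r < 2` and
`log n = O(n ^ (2 / r - 1) (log n) ^ (1 / r))`: blobs of the intended size have more than `3 log n`
vertices, so sets of `3 n log n` vertices are still small. When `r = 1` a matching already gives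
`f(n, H) ≤ n`.
-/

namespace SplitGraph

open Finset SimpleGraph Filter Asymptotics

section Exponents

theorem le_of_natCast_rpow_isBigO {a b : ℝ}
    (h : (fun n : ℕ => (n : ℝ) ^ a) =O[atTop] fun n : ℕ => (n : ℝ) ^ b) : a ≤ b := by
  by_contra! hba
  have hdiv : (fun n : ℕ => (n : ℝ) ^ b) =o[atTop] fun n : ℕ => (n : ℝ) ^ a := by
    refine (isLittleO_iff_tendsto' ?_).2 ?_
    · filter_upwards [eventually_gt_atTop 0] with n hn h0
      exact absurd h0 (by positivity)
    · refine Tendsto.congr' ?_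
        ((tendsto_rpow_neg_atTop (sub_pos.2 hba)).comp tendsto_natCast_atTop_atTop)
      filter_upwards [eventually_gt_atTop 0] with n hn
      rw [Function.comp_apply, neg_sub, Real.rpow_sub (by positivity)]
  refine (hdiv.trans_isBigO h).not_isBigO ?_ (isBigO_refl _ _)
  exact (eventually_gt_atTop 0).frequently.mono fun n hn => by positivity

theorem lt_of_natCast_rpow_isLittleO {a b : ℝ}
    (h : (fun n : ℕ => (n : ℝ) ^ a) =o[atTop] fun n : ℕ => (n : ℝ) ^ b) : a < b := by
  refine (le_of_natCast_rpow_isBigO h.isBigO).lt_of_ne ?_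
  rintro rfl
  refine isLittleO_irrefl ?_ h
  exact (eventually_gt_atTop 0).frequently.mono fun n hn => by positivity

theorem self_mul_rpow_two_div_sub_one {x : ℝ} (hx : 0 < x) (r : ℝ) :
    x * x ^ (2 / r - 1) = (x ^ 2) ^ (1 / r) := by
  rw [Real.rpow_sub_one hx.ne', mul_div_cancel₀ _ hx.ne', ← Real.rpow_two, ← Real.rpow_mul hx.le,
    mul_one_div]

theorem log_rpow_le_mul_rpow {a b x : ℝ} (ha : 0 < a) (hb : 0 < b) (hx : 1 ≤ x) :
    Real.log x ^ a ≤ (a / b) ^ a * x ^ b := by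
  have hlog : Real.log x ≤ a / b * x ^ (b / a) := by
    have h := Real.log_le_rpow_div (zero_le_one.trans hx) (div_pos hb ha)
    rwa [div_eq_inv_mul, inv_div] at h
  calc Real.log x ^ a ≤ (a / b * x ^ (b / a)) ^ a :=
        Real.rpow_le_rpow (Real.log_nonneg hx) hlog ha.le
    _ = (a / b) ^ a * x ^ b := by
        rw [Real.mul_rpow (by positivity) (by positivity), ← Real.rpow_mul (by positivity),
          div_mul_cancel₀ _ ha.ne']

theorem exists_mul_rpow_neg_le (K : ℝ) {a η : ℝ} (ha : 0 < a) (hη : 0 < η) :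
    ∃ m : ℕ, 0 < m ∧ K * (m : ℝ) ^ (-a) ≤ η := by
  have hlim : Tendsto (fun m : ℕ => K * (m : ℝ) ^ (-a)) atTop (nhds (K * 0)) :=
    ((tendsto_rpow_neg_atTop ha).comp tendsto_natCast_atTop_atTop).const_mul K
  rw [mul_zero] at hlim
  exact ((eventually_gt_atTop 0).and (hlim.eventually_le_const hη)).exists

theorem half_le_log {n : ℕ} (hn : 2 ≤ n) : 1 / 2 ≤ Real.log n := by
  have hmono : Real.log 2 ≤ Real.log n := Real.log_le_log two_pos (mod_cast hn)
  linarith [Real.log_two_gt_d9]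

theorem mul_self_mul_exp_neg_lt_one {n : ℕ} (hn : 2 ≤ n) :
    (n * n : ℝ) * Real.exp (-(3 * (n * Real.log n) / n)) < 1 := by
  have hn0 : (0 : ℝ) < n := by positivity
  have hexp : Real.exp (-(3 * (n * Real.log n) / n)) = ((n : ℝ) ^ 3)⁻¹ := by
    rw [mul_left_comm, mul_div_cancel_left₀ _ hn0.ne', Real.exp_neg, ← Nat.cast_ofNat (n := 3),
      Real.exp_nat_mul, Real.exp_log hn0]
  rw [hexp, ← sq, ← div_eq_mul_inv, div_lt_one (by positivity)]
  exact pow_lt_pow_right₀ (by exact_mod_cast hn) (by norm_num)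

/-- The order of magnitude of the upper bound on `f n H` when `ex(ℓ, H) = Θ(ℓ ^ r)`. -/
noncomputable def upperRate (r : ℝ) (n : ℕ) : ℝ :=
  (n : ℝ) ^ (2 / r - 1) * Real.log n ^ (1 / r)

theorem upperRate_nonneg {r : ℝ} {n : ℕ} : 0 ≤ upperRate r n :=
  mul_nonneg (by positivity) (Real.rpow_nonneg (Real.log_natCast_nonneg n) _)

theorem mul_upperRate_rpow {r : ℝ} (hr : r ≠ 0) {n : ℕ} (hn : 0 < n) :
    ((n : ℝ) * upperRate r n) ^ r = (n : ℝ) ^ 2 * Real.log n := by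
  have hlog : 0 ≤ Real.log n := Real.log_natCast_nonneg n
  rw [upperRate, ← mul_assoc, self_mul_rpow_two_div_sub_one (by positivity),
    ← Real.mul_rpow (by positivity) hlog, ← Real.rpow_mul (by positivity),
    one_div_mul_cancel hr, Real.rpow_one]

theorem one_le_mul_upperRate {r : ℝ} (hr : 0 < r) {n : ℕ} (hn : 2 ≤ n) :
    1 ≤ n * upperRate r n := by
  have hR : 0 ≤ n * upperRate r n := mul_nonneg n.cast_nonneg upperRate_nonneg
  rw [← Real.rpow_le_rpow_iff zero_le_one hR hr, Real.one_rpow,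
    mul_upperRate_rpow hr.ne' (by omega)]
  have hn' : (2 : ℝ) ≤ n := mod_cast hn
  nlinarith [half_le_log hn]

theorem mul_sq_mul_log_le {r L p : ℝ} (hr : 1 ≤ r) (hL : 1 ≤ L) {n : ℕ} (hn : 0 < n)
    (hp : L * upperRate r n ≤ p) : L * ((n : ℝ) ^ 2 * Real.log n) ≤ (p * n) ^ r := by
  have := Real.log_natCast_nonneg n
  have hR : 0 ≤ upperRate r n := upperRate_nonneg
  calc L * ((n : ℝ) ^ 2 * Real.log n) ≤ L ^ r * (n * upperRate r n) ^ r := by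
        rw [mul_upperRate_rpow (by linarith) hn]
        gcongr
        exact Real.self_le_rpow_of_one_le hL hr
    _ = (L * upperRate r n * n) ^ r := by
        rw [← Real.mul_rpow (by positivity) (by positivity)]
        ring_nf
    _ ≤ (p * n) ^ r := by gcongr

theorem exists_log_le_mul_upperRate {r : ℝ} (h1 : 1 < r) (h2 : r < 2) :
    ∃ K : ℝ, 0 < K ∧ ∀ n : ℕ, 2 ≤ n → Real.log n ≤ K * upperRate r n := by
  have hr : 0 < r := by linarith
  have ha : 0 < 1 - 1 / r := sub_pos.2 ((div_lt_one hr).2 h1)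
  have hb : 0 < 2 / r - 1 := sub_pos.2 ((one_lt_div hr).2 h2)
  refine ⟨((1 - 1 / r) / (2 / r - 1)) ^ (1 - 1 / r), by positivity, fun n hn => ?_⟩
  have hlog : 0 < Real.log n := Real.log_pos (by exact_mod_cast hn)
  calc Real.log n = Real.log n ^ (1 - 1 / r) * Real.log n ^ (1 / r) := by
        rw [← Real.rpow_add hlog, sub_add_cancel, Real.rpow_one]
    _ ≤ ((1 - 1 / r) / (2 / r - 1)) ^ (1 - 1 / r) * (n : ℝ) ^ (2 / r - 1) *
          Real.log n ^ (1 / r) := by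
        gcongr
        exact log_rpow_le_mul_rpow ha hb (by exact_mod_cast (by omega : 1 ≤ n))
    _ = _ := mul_assoc _ _ _

end Exponents

section LowerBound

/-- There is an `H`-free `(n, k)`-graph; `f n H` is the least positive such `k`. -/
def HasFreeNKGraph {W : Type*} (H : SimpleGraph W) (n k : ℕ) : Prop :=
  ∃ (V : Type) (_ : Fintype V) (G : SimpleGraph V), IsNKGraph G n k ∧ H.Free G

variable {W V : Type*} {H : SimpleGraph W} {n k : ℕ} {c r : ℝ}

theorem f_le (hk : 0 < k) (h : HasFreeNKGraph H n k) : f n H ≤ k :=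
  Nat.sInf_le ⟨hk, h⟩

theorem HasFreeNKGraph.f (hk : 0 < k) (h : HasFreeNKGraph H n k) :
    HasFreeNKGraph H n (f n H) :=
  (Nat.sInf_mem (s := {k : ℕ | 0 < k ∧ HasFreeNKGraph H n k}) ⟨k, hk, h⟩).2

theorem IsNKGraph.card_le {V : Type} [Fintype V] {G : SimpleGraph V} (h : IsNKGraph G n k) :
    Fintype.card V ≤ n * k := by
  obtain ⟨b, hb, -⟩ := h
  calc Fintype.card V = ∑ i, #{v | b v = i} :=
        card_eq_sum_card_fiberwise fun _ _ => mem_univ _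
    _ ≤ n * k := by simpa using sum_le_card_nsmul univ _ k fun i _ => hb i

theorem IsNKGraph.mul_pred_le_card_edgeFinset {V : Type} [Fintype V] {G : SimpleGraph V}
    [DecidableRel G.Adj] (h : IsNKGraph G n k) : n * (n - 1) ≤ 2 * #G.edgeFinset := by
  obtain ⟨b, -, -, hb⟩ := h
  have hpairs : (univ : Finset (Fin n)).offDiag ⊆
      ({e : V × V | G.Adj e.1 e.2} : Finset _).image (Prod.map b b) := by
    intro p hp
    obtain ⟨e, ⟨h₁, h₂, hadj⟩, -⟩ := hb p.1 p.2 (mem_offDiag.1 hp).2.2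
    exact mem_image.2 ⟨e, by simpa using hadj, Prod.ext h₁ h₂⟩
  calc n * (n - 1) = #(univ : Finset (Fin n)).offDiag := by simp [offDiag_card, Nat.mul_sub]
    _ ≤ #({e : V × V | G.Adj e.1 e.2} : Finset _) := (card_le_card hpairs).trans card_image_le
    _ = 2 * #G.edgeFinset := G.two_mul_card_edgeFinset.symm

theorem IsNKGraph.mul_pred_le_extremalNumber {V : Type} [Fintype V] {G : SimpleGraph V}
    (h : IsNKGraph G n k) (hG : H.Free G) :
    n * (n - 1) ≤ 2 * extremalNumber (Fintype.card V) H := by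
  classical
  exact h.mul_pred_le_card_edgeFinset.trans
    (Nat.mul_le_mul_left 2 (card_edgeFinset_le_extremalNumber hG))

theorem IsNKGraph.sq_le {V : Type} [Fintype V] {G : SimpleGraph V} (h : IsNKGraph G n k)
    (hG : H.Free G) (hex : ∀ l : ℕ, (extremalNumber l H : ℝ) ≤ c * (l : ℝ) ^ r) (hn : 2 ≤ n) :
    (n : ℝ) ^ 2 ≤ 4 * c * (Fintype.card V : ℝ) ^ r := by
  have hpairs : (n : ℝ) * (n - 1) ≤ 2 * extremalNumber (Fintype.card V) H := by
    have := h.mul_pred_le_extremalNumber hG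
    rw [← Nat.cast_one, ← Nat.cast_sub (by omega)]
    exact_mod_cast this
  have hn' : (2 : ℝ) ≤ n := mod_cast hn
  nlinarith [hex (Fintype.card V)]

theorem le_f_of_extremalNumber_le (hc : 0 < c) (hr : 0 < r)
    (hex : ∀ l : ℕ, (extremalNumber l H : ℝ) ≤ c * (l : ℝ) ^ r) (hn : 2 ≤ n) (hk : 0 < k)
    (h : HasFreeNKGraph H n k) :
    (1 / (4 * c)) ^ (1 / r) * (n : ℝ) ^ (2 / r - 1) ≤ f n H := by
  obtain ⟨V, _, G, hG, hfree⟩ := h.f hk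
  have hn0 : (0 : ℝ) < n := by positivity
  have hsq : 1 / (4 * c) * (n : ℝ) ^ 2 ≤ ((n : ℝ) * f n H) ^ r := by
    rw [one_div, inv_mul_le_iff₀ (by positivity)]
    calc (n : ℝ) ^ 2 ≤ 4 * c * (Fintype.card V : ℝ) ^ r := hG.sq_le hfree hex hn
      _ ≤ 4 * c * ((n : ℝ) * f n H) ^ r := by
          gcongr
          exact_mod_cast hG.card_le
  refine le_of_mul_le_mul_left ?_ hn0
  calc (n : ℝ) * ((1 / (4 * c)) ^ (1 / r) * (n : ℝ) ^ (2 / r - 1))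
      = (1 / (4 * c) * (n : ℝ) ^ 2) ^ r⁻¹ := by
        rw [mul_left_comm, self_mul_rpow_two_div_sub_one hn0,
          ← Real.mul_rpow (by positivity) (by positivity), one_div r]
    _ ≤ n * f n H := (Real.rpow_inv_le_iff_of_pos (by positivity) (by positivity) hr).2 hsq

end LowerBound

section SwapGraph

/-- The `(n, n)`-graph in which blob `i` is `{i} × Fin n` and the edge between the blobs `i ≠ j`
joins `(i, j)` to `(j, i)`. Being a matching, it contains no graph of maximum degree at least
`2`. -/
def swapGraph (n : ℕ) : SimpleGraph (Fin n × Fin n) where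
  Adj p q := p ≠ q ∧ q = p.swap
  symm := ⟨fun p q h => ⟨h.1.symm, by simp [h.2]⟩⟩
  loopless := ⟨fun _ h => h.1 rfl⟩

theorem isNKGraph_swapGraph (n : ℕ) : IsNKGraph (swapGraph n) n n := by
  refine ⟨Prod.fst, fun i => ?_, ?_, fun i j hij => ⟨((i, j), (j, i)), ?_, ?_⟩⟩
  · calc #{p : Fin n × Fin n | p.1 = i} ≤ #(univ : Finset (Fin n)) :=
          card_le_card_of_injOn Prod.snd (fun _ _ => mem_univ _) fun p hp q hq h =>
            Prod.ext (by simp_all) h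
      _ = n := Finset.card_fin n
  · rintro ⟨i, j⟩ _ ⟨hne, rfl⟩ (rfl : i = j)
    exact hne rfl
  · exact ⟨rfl, rfl, fun h => hij (congrArg Prod.fst h), rfl⟩
  · rintro ⟨p, q⟩ ⟨rfl, rfl, -, h⟩
    obtain rfl : q = p.swap := h
    rfl

variable {W : Type*} [Fintype W] {H : SimpleGraph W} [DecidableRel H.Adj] {n : ℕ}

theorem free_swapGraph (hdeg : 2 ≤ H.maxDegree) : H.Free (swapGraph n) := by
  classical
  intro h
  have hdeg_swap : (swapGraph n).maxDegree ≤ 1 :=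
    maxDegree_le_of_forall_degree_le _ _ fun p => by
      rw [← card_neighborFinset_eq_degree]
      refine card_le_one_iff.2 fun hq hq' => ?_
      rw [mem_neighborFinset] at hq hq'
      exact hq.2.trans hq'.2.symm
  have := h.maxDegree_mono
  omega

theorem hasFreeNKGraph_self (hdeg : 2 ≤ H.maxDegree) (n : ℕ) : HasFreeNKGraph H n n :=
  ⟨_, _, swapGraph n, isNKGraph_swapGraph n, free_swapGraph hdeg⟩

theorem one_le_of_extremalNumber_le (hdeg : 2 ≤ H.maxDegree) {c r : ℝ}
    (hex : ∀ l : ℕ, (extremalNumber l H : ℝ) ≤ c * (l : ℝ) ^ r) : 1 ≤ r := by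
  have hsq : ∀ n : ℕ, 2 ≤ n → (n : ℝ) ^ (2 : ℝ) ≤ 4 * c * (n : ℝ) ^ (2 * r) := by
    intro n hn
    have h := (isNKGraph_swapGraph n).sq_le (free_swapGraph hdeg) hex hn
    rwa [Fintype.card_prod, Fintype.card_fin, Nat.cast_mul, ← sq, ← Real.rpow_two,
      ← Real.rpow_mul (by positivity)] at h
  have hO : (fun n : ℕ => (n : ℝ) ^ (2 : ℝ)) =O[atTop] fun n : ℕ => (n : ℝ) ^ (2 * r) := by
    refine IsBigO.of_bound (4 * c) ?_
    filter_upwards [eventually_ge_atTop 2] with n hn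
    rw [Real.norm_of_nonneg (by positivity), Real.norm_of_nonneg (by positivity)]
    exact hsq n hn
  linarith [le_of_natCast_rpow_isBigO hO]

end SwapGraph

section ExtremalNumber

variable {W : Type*} {H : SimpleGraph W} {c r : ℝ}

theorem extremalNumber_zero (H : SimpleGraph W) : extremalNumber 0 H = 0 := by
  rw [← Nat.le_zero, ← Fintype.card_fin 0, extremalNumber_le_iff]
  exact fun G _ _ => G.card_edgeFinset_le_card_choose_two

theorem exists_forall_extremalNumber_le
    (hex : (fun l : ℕ => (extremalNumber l H : ℝ)) =O[atTop] fun l : ℕ => (l : ℝ) ^ r) :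
    ∃ c : ℝ, 0 < c ∧ ∀ l : ℕ, (extremalNumber l H : ℝ) ≤ c * (l : ℝ) ^ r := by
  obtain ⟨c, hc, h⟩ := bound_of_isBigO_nat_atTop hex
  refine ⟨c, hc, fun l => ?_⟩
  rcases l.eq_zero_or_pos with rfl | hl
  · rw [extremalNumber_zero, Nat.cast_zero]
    positivity
  · have hpow : 0 < (l : ℝ) ^ r := by positivity
    simpa [abs_of_pos hpow] using h hpow.ne'

theorem exists_forall_ge_le_extremalNumber
    (hex : (fun l : ℕ => (l : ℝ) ^ r) =O[atTop] fun l : ℕ => (extremalNumber l H : ℝ)) :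
    ∃ c : ℝ, 0 < c ∧ ∃ N : ℕ, ∀ l : ℕ, N ≤ l → c * (l : ℝ) ^ r ≤ extremalNumber l H := by
  obtain ⟨c, hc, h⟩ := hex.exists_pos
  obtain ⟨N, hN⟩ := eventually_atTop.1 h.bound
  refine ⟨c⁻¹, by positivity, N, fun l hl => ?_⟩
  have hpow : 0 ≤ (l : ℝ) ^ r := by positivity
  rw [inv_mul_le_iff₀ hc]
  simpa [abs_of_nonneg hpow] using hN l hl

theorem eventually_extremalNumber_succ_le [Finite W] (hbip : H.IsBipartite) {ε : ℝ} (hε : 0 < ε) :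
    ∀ᶠ n : ℕ in atTop,
      (extremalNumber (n + 1) H : ℝ) ≤ extremalNumber n H + ε * (n + 1 : ℕ) := by
  classical
  have := Fintype.ofFinite W
  obtain ⟨C⟩ := hbip
  have hH : H ⊑ completeEquipartiteGraph (1 + 1) (Fintype.card W) :=
    isContained_completeEquipartiteGraph_of_colorable C _ fun c => Fintype.card_subtype_le _
  have hminDegree := (tendsto_add_atTop_nat 1).eventually
    (eventually_completeEquipartiteGraph_isContained_of_minDegree hε 1 (Fintype.card W))
  filter_upwards [hminDegree] with n hn
  rw [← Fintype.card_fin (n + 1), extremalNumber_le_iff_of_nonneg _ (by positivity),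
    Fintype.card_fin]
  intro G _ hG
  obtain ⟨v, hv⟩ := G.exists_minimal_degree_vertex
  have hdeg : (G.degree v : ℝ) < ε * (n + 1 : ℕ) := by
    by_contra! h
    refine hG (hH.trans (hn ?_))
    rwa [hv, Nat.cast_one, div_one, sub_self, zero_add]
  have hdelete : #G.edgeFinset - G.degree v ≤ extremalNumber n H := by
    simpa [card_edgeFinset_deleteIncidenceSet] using
      card_edgeFinset_deleteIncidenceSet_le_extremalNumber hG v
  have : (#G.edgeFinset : ℝ) ≤ extremalNumber n H + G.degree v :=
    mod_cast Nat.sub_le_iff_le_add.1 hdelete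
  linarith

theorem isLittleO_extremalNumber_sq [Finite W] (hbip : H.IsBipartite) :
    (fun n : ℕ => (extremalNumber n H : ℝ)) =o[atTop] fun n : ℕ => (n : ℝ) ^ (2 : ℝ) := by
  refine isLittleO_iff.2 fun ε hε => ?_
  obtain ⟨n₀, hn₀⟩ := eventually_atTop.1 (eventually_extremalNumber_succ_le hbip (half_pos hε))
  have hbound : ∀ n, n₀ ≤ n →
      (extremalNumber n H : ℝ) ≤ extremalNumber n₀ H + ε / 2 * (n : ℝ) ^ 2 := by
    intro n hn
    induction n, hn using Nat.le_induction with
    | base => exact le_add_of_nonneg_right (by positivity)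
    | succ n hn ih =>
      have := hn₀ n hn
      push_cast at this ⊢
      nlinarith [show 0 ≤ ε * n by positivity]
  have hsq : Tendsto (fun n : ℕ => ε / 2 * (n : ℝ) ^ 2) atTop atTop :=
    ((tendsto_pow_atTop two_ne_zero).comp tendsto_natCast_atTop_atTop).const_mul_atTop
      (half_pos hε)
  filter_upwards [eventually_ge_atTop n₀, hsq.eventually_ge_atTop (extremalNumber n₀ H : ℝ)]
    with n hn hn'
  rw [Real.rpow_two, Real.norm_natCast, Real.norm_of_nonneg (by positivity)]
  linarith [hbound n hn]

end ExtremalNumber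

section Realisation

variable {W : Type*} {H : SimpleGraph W} {n k : ℕ}

theorem exists_le_isNKGraph {V : Type} [Fintype V] (G : SimpleGraph V) (b : V → Fin n)
    (hb : ∀ i, #{v | b v = i} ≤ k)
    (hadj : ∀ i j, i < j → ∃ u v, b u = i ∧ b v = j ∧ G.Adj u v) :
    ∃ G' ≤ G, IsNKGraph G' n k := by
  choose x y hx hy hxy using hadj
  let G' : SimpleGraph V :=
    { Adj u v := (∃ h, x (b u) (b v) h = u ∧ y (b u) (b v) h = v) ∨
        ∃ h, x (b v) (b u) h = v ∧ y (b v) (b u) h = u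
      symm := ⟨fun _ _ => Or.symm⟩
      loopless := ⟨fun _ h => h.elim (fun h => h.1.false) fun h => h.1.false⟩ }
  refine ⟨G', ?_, b, hb, ?_, fun i j hij => ?_⟩
  · rintro u v (⟨h, hu, hv⟩ | ⟨h, hv, hu⟩)
    · simpa only [hu, hv] using hxy _ _ h
    · simpa only [hu, hv] using (hxy _ _ h).symm
  · rintro u v (⟨h, -⟩ | ⟨h, -⟩)
    exacts [h.ne, h.ne']
  · rcases hij.lt_or_gt with h | h
    · refine ⟨(x i j h, y i j h), ⟨hx .., hy .., Or.inl ?_⟩, ?_⟩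
      · simp [hx, hy, h]
      · rintro ⟨u, v⟩ ⟨rfl, rfl, ⟨_, hu, hv⟩ | ⟨h', -⟩⟩
        · exact Prod.ext hu.symm hv.symm
        · exact absurd h' h.asymm
    · refine ⟨(y j i h, x j i h), ⟨hy .., hx .., Or.inr ?_⟩, ?_⟩
      · simp [hx, hy, h]
      · rintro ⟨u, v⟩ ⟨rfl, rfl, ⟨h', -⟩ | ⟨_, hv, hu⟩⟩
        · exact absurd h' h.asymm
        · exact Prod.ext hu.symm hv.symm

theorem hasFreeNKGraph_of_pairwise_disjoint {V : Type} {G : SimpleGraph V} (hG : H.Free G)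
    (P : Fin n → Finset V) (hP : Pairwise (Function.onFun Disjoint P)) (hcard : ∀ i, #(P i) ≤ k)
    (hadj : ∀ i j, i < j → ∃ u ∈ P i, ∃ v ∈ P j, G.Adj u v) : HasFreeNKGraph H n k := by
  let φ : (Σ i, P i) ↪ V := ⟨fun p => p.2, by
    rintro ⟨i, u, hu⟩ ⟨j, v, hv⟩ (rfl : u = v)
    obtain rfl : i = j := hP.eq (not_disjoint_iff.2 ⟨u, hu, hv⟩)
    rfl⟩
  have hfibre : ∀ i, #{p : Σ i, P i | p.1 = i} ≤ k := fun i => by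
    refine (card_le_card_of_injOn φ ?_ φ.injective.injOn).trans (hcard i)
    rintro ⟨j, v⟩ hj
    obtain rfl : j = i := by simpa using hj
    exact v.2
  obtain ⟨G', hle, hG'⟩ := exists_le_isNKGraph (G.comap φ) Sigma.fst hfibre fun i j hij => by
    obtain ⟨u, hu, v, hv, huv⟩ := hadj i j hij
    exact ⟨⟨i, u, hu⟩, ⟨j, v, hv⟩, rfl, rfl, huv⟩
  exact ⟨_, _, G', hG', fun h => hG ((h.mono_right hle).trans (Embedding.comap φ G).isContained)⟩

end Realisation

section Interedges

variable {W V : Type*} {H : SimpleGraph W} (G : SimpleGraph V) [DecidableRel G.Adj]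

theorem card_interedges_eq_sum (A B : Finset V) :
    #(G.interedges A B) = ∑ a ∈ A, #{b ∈ B | G.Adj a b} := by
  simp_rw [SimpleGraph.interedges, Rel.interedges, card_filter, sum_product]

theorem card_interedges_univ_univ [Fintype V] :
    #(G.interedges univ univ) = 2 * #G.edgeFinset := by
  rw [two_mul_card_edgeFinset, SimpleGraph.interedges, Rel.interedges, univ_product_univ]

variable {G}

theorem card_interedges_self_le (hG : H.Free G) (S : Finset V) :
    #(G.interedges S S) ≤ 2 * extremalNumber #S H := by
  classical
  have hfree : H.Free (G.induce (S : Set V)) := fun h => hG (h.trans ⟨Copy.induce G _⟩)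
  have hsub : G.interedges S S ⊆
      ((G.induce (S : Set V)).interedges univ univ).map
        ((Function.Embedding.subtype _).prodMap (Function.Embedding.subtype _)) := by
    rintro ⟨u, v⟩ h
    obtain ⟨hu, hv, huv⟩ := Rel.mem_interedges_iff.1 h
    exact mem_map.2 ⟨(⟨u, hu⟩, ⟨v, hv⟩), by simpa [SimpleGraph.mem_interedges_iff] using huv, rfl⟩
  calc #(G.interedges S S) ≤ #((G.induce (S : Set V)).interedges univ univ) := by
        simpa only [card_map] using card_le_card hsub
    _ = 2 * #(G.induce (S : Set V)).edgeFinset := card_interedges_univ_univ _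
    _ ≤ 2 * extremalNumber #S H := by
        simpa using card_edgeFinset_le_extremalNumber hfree

theorem card_interedges_le_mul_of_card_le {S : Finset V} {p : ℕ} {B : ℝ}
    (hB : ∀ T : Finset V, #T ≤ p → (#(G.interedges S T) : ℝ) ≤ B) {m : ℕ} {T : Finset V}
    (hT : #T ≤ m * p) : (#(G.interedges S T) : ℝ) ≤ m * B := by
  classical
  induction m generalizing T with
  | zero =>
    obtain rfl : T = ∅ := by simpa using hT
    simp [card_interedges_eq_sum]
  | succ m ih =>
    obtain ⟨T', hT', hcard⟩ := exists_subset_card_eq (min_le_left #T p)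
    have hrest : #(T \ T') ≤ m * p := by
      rw [card_sdiff_of_subset hT', hcard]
      rw [Nat.succ_mul] at hT
      omega
    have hsplit : #(G.interedges S T) ≤ #(G.interedges S (T \ T')) + #(G.interedges S T') := by
      simp_rw [card_interedges_eq_sum, ← sum_add_distrib]
      refine sum_le_sum fun a _ => ?_
      rw [← sdiff_union_of_subset hT', filter_union]
      simpa only [sdiff_union_of_subset hT'] using card_union_le _ _
    calc (#(G.interedges S T) : ℝ) ≤ #(G.interedges S (T \ T')) + #(G.interedges S T') :=
          mod_cast hsplit
      _ ≤ m * B + B := add_le_add (ih hrest) (hB T' (hcard.trans_le (min_le_right _ _)))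
      _ = (m + 1 : ℕ) * B := by push_cast; ring

theorem card_interedges_le_of_card_le {c r : ℝ} (hc : 0 ≤ c) (hr : 0 ≤ r)
    (hex : ∀ l : ℕ, (extremalNumber l H : ℝ) ≤ c * (l : ℝ) ^ r) (hG : H.Free G) {p : ℕ}
    {S T : Finset V} (hS : #S ≤ p) (hT : #T ≤ p) :
    (#(G.interedges S T) : ℝ) ≤ 2 * c * (2 * p : ℝ) ^ r := by
  classical
  have hcard : #(S ∪ T) ≤ 2 * p := (card_union_le S T).trans (by omega)
  calc (#(G.interedges S T) : ℝ) ≤ #(G.interedges (S ∪ T) (S ∪ T)) := by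
        exact_mod_cast card_le_card (Rel.interedges_mono subset_union_left subset_union_right)
    _ ≤ 2 * extremalNumber #(S ∪ T) H := mod_cast card_interedges_self_le hG _
    _ ≤ 2 * (c * (#(S ∪ T) : ℝ) ^ r) := by gcongr; exact hex _
    _ ≤ 2 * (c * (2 * p : ℝ) ^ r) := by gcongr; exact_mod_cast hcard
    _ = 2 * c * (2 * p : ℝ) ^ r := by ring

theorem card_interedges_univ_le_of_mul_card_le [Fintype V] {c r : ℝ} (hc : 0 ≤ c) (hr : 0 ≤ r)
    (hex : ∀ l : ℕ, (extremalNumber l H : ℝ) ≤ c * (l : ℝ) ^ r) (hG : H.Free G) {m : ℕ}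
    (hm : 0 < m) {S : Finset V} (hS : m * #S ≤ Fintype.card V) :
    (#(G.interedges S univ) : ℝ) ≤
      2 * c * 4 ^ r * (m : ℝ) ^ (-(r - 1)) * (Fintype.card V : ℝ) ^ r := by
  rcases S.eq_empty_or_nonempty with rfl | hne
  · simpa [card_interedges_eq_sum] using by positivity
  set l := Fintype.card V
  have hm0 : (0 : ℝ) < m := mod_cast hm
  have hSl : (#S : ℝ) ≤ l / m := (le_div_iff₀' hm0).2 (mod_cast hS)
  have hone : (1 : ℝ) ≤ l / m := hSl.trans' (mod_cast hne.card_pos)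
  set p := ⌈(l / m : ℝ)⌉₊
  have hlp : (l : ℝ) ≤ m * p := (div_le_iff₀' hm0).1 (Nat.le_ceil _)
  have hpl : (p : ℝ) ≤ 2 * (l / m) := by
    linarith [Nat.ceil_lt_add_one (zero_le_one.trans hone)]
  have hSp : #S ≤ p := mod_cast hSl.trans (Nat.le_ceil _)
  calc (#(G.interedges S univ) : ℝ) ≤ m * (2 * c * (2 * p : ℝ) ^ r) :=
        card_interedges_le_mul_of_card_le
          (fun T hT => card_interedges_le_of_card_le hc hr hex hG hSp hT) (mod_cast hlp)
    _ ≤ m * (2 * c * (4 * (l / m) : ℝ) ^ r) := by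
        gcongr m * (2 * c * ?_ ^ r)
        linarith
    _ = 2 * c * 4 ^ r * (m : ℝ) ^ (-(r - 1)) * (l : ℝ) ^ r := by
        rw [Real.mul_rpow (by positivity) (by positivity), Real.div_rpow (by positivity) hm0.le,
          neg_sub, Real.rpow_sub hm0, Real.rpow_one]
        ring

end Interedges

section Cut

theorem exists_cut {V : Type*} [DecidableEq V] (w : V → V → ℕ) (hsymm : ∀ x y, w x y = w y x)
    (hdiag : ∀ x, w x x = 0) (S : Finset V) :
    ∃ A B : Finset V, A ∪ B = S ∧ Disjoint A B ∧
      ∑ x ∈ S, ∑ y ∈ S, w x y ≤ 4 * ∑ x ∈ A, ∑ y ∈ B, w x y := by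
  induction S using Finset.induction_on with
  | empty => exact ⟨∅, ∅, by simp, by simp, by simp⟩
  | insert v S hv ih =>
    obtain ⟨A, B, rfl, hAB, h⟩ := ih
    rw [mem_union, not_or] at hv
    have htotal : ∑ x ∈ insert v (A ∪ B), ∑ y ∈ insert v (A ∪ B), w x y =
        ∑ x ∈ A ∪ B, ∑ y ∈ A ∪ B, w x y + 2 * (∑ y ∈ A, w v y + ∑ y ∈ B, w v y) := by
      simp only [sum_insert (mem_union.not.2 (not_or.2 hv)), sum_add_distrib, hdiag, hsymm _ v,
        sum_union hAB]
      ring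
    -- The new vertex joins the side on which it has less weight.
    rcases le_total (∑ y ∈ A, w v y) (∑ y ∈ B, w v y) with hle | hle
    · refine ⟨insert v A, B, insert_union .., by simp [hv.2, hAB], ?_⟩
      rw [htotal, sum_insert hv.1]
      omega
    · refine ⟨A, insert v B, union_insert .., by simp [hv.1, hAB], ?_⟩
      simp only [htotal, sum_insert hv.2, sum_add_distrib, hsymm _ v]
      omega

theorem exists_disjoint_card_edgeFinset_le {V : Type*} [Fintype V] (G : SimpleGraph V)
    [DecidableRel G.Adj] :
    ∃ A B : Finset V, Disjoint A B ∧ #G.edgeFinset ≤ 2 * #(G.interedges A B) := by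
  classical
  obtain ⟨A, B, -, hAB, h⟩ := exists_cut (fun x y => if G.Adj x y then 1 else 0)
    (fun x y => by simp only [G.adj_comm]) (by simp) univ
  simp_rw [← card_filter, ← card_interedges_eq_sum, card_interedges_univ_univ] at h
  exact ⟨A, B, hAB, by omega⟩

end Cut

section Greedy

variable {V : Type*}

/-- The neighbours in `B` of the set `P`, the colours available to a blob with core `P`. -/
def nbrs (G : SimpleGraph V) [DecidableRel G.Adj] (B P : Finset V) : Finset V :=
  {v ∈ B | ∃ u ∈ P, G.Adj u v}

theorem card_nbrs_insert [DecidableEq V] (G : SimpleGraph V) [DecidableRel G.Adj]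
    (B P : Finset V) (a : V) :
    #(nbrs G B (insert a P)) = #(nbrs G B P) + #{v ∈ B \ nbrs G B P | G.Adj a v} := by
  rw [← card_union_of_disjoint (disjoint_sdiff.mono_right (filter_subset _ _))]
  congr 1
  ext v
  simp only [nbrs, mem_filter, mem_union, Finset.mem_sdiff, exists_mem_insert]
  grind

variable [Fintype V] {G : SimpleGraph V} [DecidableRel G.Adj] {A B U : Finset V} {η d : ℝ} {s : ℕ}

theorem exists_le_card_filter_adj_sdiff [DecidableEq V]
    (hs : ∀ S : Finset V, #S ≤ s → (#(G.interedges S univ) : ℝ) ≤ η) (hd : 0 ≤ d)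
    (hAB : 2 * η + d * Fintype.card V < #(G.interedges A B)) {N : Finset V}
    (hU : #U ≤ s) (hN : #N ≤ s) : ∃ a ∈ A \ U, d ≤ #{v ∈ B \ N | G.Adj a v} := by
  by_contra! hfew
  have hcover : #(G.interedges A B) ≤
      #(G.interedges U univ) + #(G.interedges univ N) + #(G.interedges (A \ U) (B \ N)) := by
    refine (card_le_card ?_).trans
      ((card_union_le _ _).trans (Nat.add_le_add_right (card_union_le _ _) _))
    intro e he
    simp only [SimpleGraph.mem_interedges_iff, mem_union, Finset.mem_sdiff, mem_univ] at he ⊢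
    tauto
  have hcomm : #(G.interedges univ N) = #(G.interedges N univ) :=
    have := G.symm
    Rel.card_interedges_comm _ _
  have hrest : (#(G.interedges (A \ U) (B \ N)) : ℝ) ≤ d * Fintype.card V := by
    calc (#(G.interedges (A \ U) (B \ N)) : ℝ)
        = ∑ a ∈ A \ U, (#{v ∈ B \ N | G.Adj a v} : ℝ) := by
          simp_rw [card_interedges_eq_sum, Nat.cast_sum]
      _ ≤ ∑ _a ∈ A \ U, d := sum_le_sum fun a ha => (hfew a ha).le
      _ = d * #(A \ U) := by rw [sum_const, nsmul_eq_mul, mul_comm]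
      _ ≤ d * Fintype.card V := by gcongr; exact card_le_univ _
  have : (#(G.interedges A B) : ℝ) ≤
      #(G.interedges U univ) + #(G.interedges N univ) + #(G.interedges (A \ U) (B \ N)) := by
    exact_mod_cast hcomm ▸ hcover
  linarith [hs U hU, hs N hN]

theorem exists_le_card_nbrs (hs : ∀ S : Finset V, #S ≤ s → (#(G.interedges S univ) : ℝ) ≤ η)
    (hd : 0 ≤ d) (hAB : 2 * η + d * Fintype.card V < #(G.interedges A B)) (hU : #U ≤ s)
    {M : ℝ} (hM : M ≤ s) {t : ℕ} (ht : M ≤ t * d) :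
    ∃ P ⊆ A, Disjoint P U ∧ #P ≤ t ∧ M ≤ #(nbrs G B P) := by
  classical
  suffices hgrow : ∀ j : ℕ, ∃ P ⊆ A, Disjoint P U ∧ #P ≤ j ∧
      (M ≤ #(nbrs G B P) ∨ j * d ≤ #(nbrs G B P)) by
    obtain ⟨P, hPA, hPU, hPt, h⟩ := hgrow t
    exact ⟨P, hPA, hPU, hPt, h.elim id ht.trans⟩
  intro j
  induction j with
  | zero => exact ⟨∅, by simp, by simp, by simp, Or.inr (by simp)⟩
  | succ j ih =>
    obtain ⟨P, hPA, hPU, hPj, h⟩ := ih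
    by_cases hPM : M ≤ #(nbrs G B P)
    · exact ⟨P, hPA, hPU, hPj.trans j.le_succ, Or.inl hPM⟩
    have hPs : #(nbrs G B P) ≤ s := mod_cast (le_of_not_ge hPM).trans hM
    obtain ⟨a, ha, hda⟩ := exists_le_card_filter_adj_sdiff hs hd hAB hU hPs
    rw [Finset.mem_sdiff] at ha
    refine ⟨insert a P, insert_subset ha.1 hPA, by simp [ha.2, hPU],
      (card_insert_le _ _).trans (by omega), Or.inr ?_⟩
    rw [card_nbrs_insert]
    push_cast
    linarith [h.resolve_left hPM]

theorem exists_pairwise_disjoint {V : Type*} {p : Finset V → Prop} {n t : ℕ}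
    (h : ∀ U : Finset V, #U ≤ n * t → ∃ P, p P ∧ #P ≤ t ∧ Disjoint P U) :
    ∃ P : Fin n → Finset V, Pairwise (Function.onFun Disjoint P) ∧ ∀ i, p (P i) ∧ #(P i) ≤ t := by
  classical
  suffices hm : ∀ m ≤ n, ∃ P : Fin m → Finset V,
      Pairwise (Function.onFun Disjoint P) ∧ ∀ i, p (P i) ∧ #(P i) ≤ t from hm n le_rfl
  intro m
  induction m with
  | zero => exact fun _ => ⟨fun _ => ∅, fun i => i.elim0, fun i => i.elim0⟩
  | succ m ih =>
    intro hm
    obtain ⟨P, hdisj, hP⟩ := ih (by omega)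
    have hU : #(univ.biUnion P) ≤ n * t := by
      refine (card_biUnion_le_card_mul _ _ t fun i _ => (hP i).2).trans ?_
      rw [Finset.card_fin]
      gcongr
      omega
    obtain ⟨Q, hpQ, hQt, hQ⟩ := h _ hU
    have hQP : ∀ i, Disjoint Q (P i) := fun i =>
      hQ.mono_right (subset_biUnion_of_mem P (mem_univ i))
    refine ⟨Fin.cons Q P, ?_, Fin.cases ⟨hpQ, hQt⟩ hP⟩
    refine fun i j => Fin.cases (Fin.cases (fun h => absurd rfl h) fun j _ => hQP j)
      (fun i => Fin.cases (fun _ => (hQP i).symm) fun j hij => hdisj (ne_of_apply_ne _ hij)) i j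

end Greedy

section Colouring

variable {ι κ α : Type*} [Fintype α]

theorem card_forall_ne_le [Fintype κ] [DecidableEq κ] [DecidableEq α] (T : Finset (κ × α)) :
    (#{x : κ → α | ∀ v ∈ T, x v.1 ≠ v.2} : ℝ) ≤
      Fintype.card (κ → α) * Real.exp (-(#T / Fintype.card α)) := by
  let R : κ → Finset α := fun k => {a | (k, a) ∈ T}
  have hpi : ({x : κ → α | ∀ v ∈ T, x v.1 ≠ v.2} : Finset _) =
      Fintype.piFinset fun k => (R k)ᶜ := by
    ext x
    simp only [mem_filter, mem_univ, true_and, Fintype.mem_piFinset, mem_compl, R]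
    exact ⟨fun h k hk => h _ hk rfl, fun h v hv hx => h v.1 (hx ▸ hv)⟩
  have hT : ∑ k, (#(R k) : ℝ) = #T := by
    simp_rw [R, card_filter, Nat.cast_sum, ← Fintype.sum_prod_type']
    simp
  have hcompl : ∀ k, (#(R k)ᶜ : ℝ) ≤
      Fintype.card α * Real.exp (-(#(R k) / Fintype.card α)) := by
    intro k
    rcases isEmpty_or_nonempty α
    · simp [eq_empty_of_isEmpty]
    calc (#(R k)ᶜ : ℝ) = Fintype.card α * (-(#(R k) / Fintype.card α) + 1) := by
          rw [card_compl, Nat.cast_sub (card_le_univ _)]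
          field
      _ ≤ _ := by gcongr; exact Real.add_one_le_exp _
  calc (#{x : κ → α | ∀ v ∈ T, x v.1 ≠ v.2} : ℝ) = ∏ k, (#(R k)ᶜ : ℝ) := by
        rw [hpi, Fintype.card_piFinset, Nat.cast_prod]
    _ ≤ ∏ k, Fintype.card α * Real.exp (-(#(R k) / Fintype.card α)) :=
        prod_le_prod (fun _ _ => Nat.cast_nonneg _) fun k _ => hcompl k
    _ = Fintype.card (κ → α) * Real.exp (-(#T / Fintype.card α)) := by
        rw [prod_mul_distrib, ← Real.exp_sum, sum_neg_distrib, ← sum_div, hT]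
        simp

variable [AddGroup α]

theorem card_forall_add_ne_le [Fintype κ] [DecidableEq κ] [DecidableEq α] (S : Finset (κ × α))
    (c : α) :
    (#{x : κ → α | ∀ v ∈ S, v.2 + x v.1 ≠ c} : ℝ) ≤
      Fintype.card (κ → α) * Real.exp (-(#S / Fintype.card α)) := by
  let e : κ × α ↪ κ × α :=
    (Function.Embedding.refl κ).prodMap ((Equiv.neg α).trans (Equiv.addRight c)).toEmbedding
  have hS : ∀ x : κ → α, (∀ v ∈ S.map e, x v.1 ≠ v.2) ↔ ∀ v ∈ S, v.2 + x v.1 ≠ c := fun x =>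
    forall_mem_map.trans (forall₂_congr fun _ _ => eq_neg_add_iff_add_eq.not)
  simpa only [hS, card_map] using card_forall_ne_le (S.map e)

theorem exists_forall_exists_add_eq [Finite κ] [Fintype ι] (S : ι → Finset (κ × α)) {M : ℝ}
    (hS : ∀ i, M ≤ #(S i))
    (hM : Fintype.card ι * Fintype.card α * Real.exp (-(M / Fintype.card α)) < 1) :
    ∃ x : κ → α, ∀ i c, ∃ v ∈ S i, v.2 + x v.1 = c := by
  classical
  have := Fintype.ofFinite κ
  let bad : ι × α → Finset (κ → α) := fun p => {x | ∀ v ∈ S p.1, v.2 + x v.1 ≠ p.2}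
  have hbad : ∀ p, (#(bad p) : ℝ) ≤
      Fintype.card (κ → α) * Real.exp (-(M / Fintype.card α)) := fun p =>
    (card_forall_add_ne_le (S p.1) p.2).trans (by gcongr; exact hS p.1)
  have hcard : (#(univ.biUnion bad) : ℝ) < #(univ : Finset (κ → α)) := by
    calc (#(univ.biUnion bad) : ℝ) ≤ ∑ p, (#(bad p) : ℝ) := mod_cast card_biUnion_le
      _ ≤ #(univ : Finset (ι × α)) • (Fintype.card (κ → α) * Real.exp (-(M / Fintype.card α))) :=
        sum_le_card_nsmul _ _ _ fun p _ => hbad p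
      _ = Fintype.card (κ → α) *
            (Fintype.card ι * Fintype.card α * Real.exp (-(M / Fintype.card α))) := by
        rw [card_univ, Fintype.card_prod, nsmul_eq_mul]
        push_cast
        ring
      _ < #(univ : Finset (κ → α)) :=
        mul_lt_of_lt_one_right (mod_cast Fintype.card_pos) hM
  obtain ⟨x, -, hx⟩ := exists_mem_notMem_of_card_lt_card (mod_cast hcard)
  exact ⟨x, fun i c => by simpa [bad] using fun h => hx (mem_biUnion.2 ⟨(i, c), mem_univ _, h⟩)⟩

end Colouring

section UpperBound

variable {W : Type*} {H : SimpleGraph W}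

theorem hasFreeNKGraph_of_dense {n q s t : ℕ} [NeZero n] {η d M : ℝ}
    {G : SimpleGraph (Fin q × Fin n)} [DecidableRel G.Adj] (hG : H.Free G)
    (hs : ∀ S : Finset (Fin q × Fin n), #S ≤ s → (#(G.interedges S univ) : ℝ) ≤ η) (hd : 0 ≤ d)
    (hcard : 2 * (2 * η + d * (q * n)) < #G.edgeFinset) (hMs : M ≤ s) (hMt : M ≤ t * d)
    (hts : n * t ≤ s) (hexp : n * n * Real.exp (-(M / n)) < 1) :
    HasFreeNKGraph H n (t + q) := by
  obtain ⟨A, B, hAB, hcut⟩ := exists_disjoint_card_edgeFinset_le G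
  have hdense : 2 * η + d * Fintype.card (Fin q × Fin n) < #(G.interedges A B) := by
    have : (#G.edgeFinset : ℝ) ≤ 2 * #(G.interedges A B) := mod_cast hcut
    rw [Fintype.card_prod, Fintype.card_fin, Fintype.card_fin, Nat.cast_mul]
    linarith
  obtain ⟨P, hdisj, hP⟩ := exists_pairwise_disjoint (n := n) (t := t)
    (p := fun P => P ⊆ A ∧ M ≤ #(nbrs G B P)) fun U hU => by
      obtain ⟨P, hPA, hPU, hPt, hPM⟩ := exists_le_card_nbrs hs hd hdense (hU.trans hts) hMs hMt
      exact ⟨P, ⟨hPA, hPM⟩, hPt, hPU⟩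
  obtain ⟨x, hx⟩ := exists_forall_exists_add_eq (fun i => nbrs G B (P i)) (fun i => (hP i).1.2)
    (by simpa using hexp)
  let colourClass : Fin n → Finset (Fin q × Fin n) := fun i => {v ∈ B | v.2 + x v.1 = i}
  have hclass : ∀ i, #(colourClass i) ≤ q := fun i => by
    refine (card_le_card_of_injOn Prod.fst (fun _ _ => mem_univ _) ?_).trans (Finset.card_fin q).le
    rintro ⟨a, u⟩ hu ⟨_, v⟩ hv (rfl : a = _)
    have huv : u + x a = v + x a := by simp_all [colourClass]
    rw [add_right_cancel huv]
  have hcore : ∀ i j, Disjoint (P i) (colourClass j) := fun i j =>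
    hAB.mono (hP i).1.1 (filter_subset _ _)
  refine hasFreeNKGraph_of_pairwise_disjoint hG (fun i => P i ∪ colourClass i) ?_ ?_ ?_
  · intro i j hij
    simp only [Function.onFun, disjoint_union_left, disjoint_union_right]
    refine ⟨⟨hdisj hij, (hcore j i).symm⟩, hcore i j, disjoint_filter.2 ?_⟩
    rintro v - rfl
    exact hij
  · exact fun i => (card_union_le _ _).trans (add_le_add (hP i).2 (hclass i))
  · intro i j _
    obtain ⟨v, hv, hvj⟩ := hx i j
    obtain ⟨hvB, u, hu, huv⟩ := mem_filter.1 hv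
    exact ⟨u, mem_union_left _ hu, v, mem_union_right _ (mem_filter.2 ⟨hvB, hvj⟩), huv⟩

variable {c c' r : ℝ} {N m : ℕ}

theorem hasFreeNKGraph_of_log_le (hne : H ≠ ⊥) (hc : 0 ≤ c) (hc' : 0 < c') (hr : 0 ≤ r)
    (hex : ∀ l : ℕ, (extremalNumber l H : ℝ) ≤ c * (l : ℝ) ^ r)
    (hex' : ∀ l : ℕ, N ≤ l → c' * (l : ℝ) ^ r ≤ extremalNumber l H) (hm : 0 < m)
    (hmc : 2 * c * 4 ^ r * (m : ℝ) ^ (-(r - 1)) ≤ c' / 16) {n p : ℕ} (hn : 2 ≤ n) (hp : 0 < p)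
    (hN : N ≤ p * n) (hlog : 3 * Real.log n ≤ p)
    (hpow : 48 * m * ((n : ℝ) ^ 2 * Real.log n) ≤ c' * (p * n : ℝ) ^ r) :
    HasFreeNKGraph H n (p + m * p) := by
  have : NeZero n := ⟨by omega⟩
  obtain ⟨G, _, hG⟩ := exists_isExtremal_free (V := Fin (m * p) × Fin n) hne
  set l : ℕ := m * p * n with hl
  have hcardV : Fintype.card (Fin (m * p) × Fin n) = l := by simp [hl]
  have hl0 : (0 : ℝ) < l := by positivity
  have hpl : p * n ≤ l := Nat.mul_le_mul_right n (Nat.le_mul_of_pos_left p hm)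
  have hlpow : 48 * m * ((n : ℝ) ^ 2 * Real.log n) ≤ c' * (l : ℝ) ^ r := by
    refine hpow.trans ?_
    gcongr
    exact_mod_cast hpl
  set d : ℝ := c' / 16 * (l : ℝ) ^ (r - 1)
  have hdl : d * l = c' / 16 * (l : ℝ) ^ r := by
    rw [mul_assoc, ← Real.rpow_add_one hl0.ne', sub_add_cancel]
  have hedges : c' * (l : ℝ) ^ r ≤ #G.edgeFinset := by
    rw [card_edgeFinset_of_isExtremal_free hG, hcardV]
    exact hex' l (hN.trans hpl)
  refine hasFreeNKGraph_of_dense (s := p * n) (M := 3 * (n * Real.log n)) (d := d)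
    (η := c' / 16 * (l : ℝ) ^ r) hG.prop ?_ (by positivity) ?_ ?_ ?_ (mul_comm n p).le ?_
  · intro S hS
    have hSl : m * #S ≤ l := by rw [hl, mul_assoc]; gcongr
    have := card_interedges_univ_le_of_mul_card_le hc hr hex hG.prop hm (hcardV ▸ hSl)
    rw [hcardV] at this
    exact this.trans (by gcongr)
  · have : 0 < c' * (l : ℝ) ^ r := by positivity
    have hcast : ((m * p : ℕ) : ℝ) * n = l := by rw [hl]; push_cast; ring
    rw [hcast, hdl]
    linarith
  · push_cast
    nlinarith
  · refine le_of_mul_le_mul_right ?_ hl0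
    calc 3 * (n * Real.log n) * l = p * (48 * m * (n ^ 2 * Real.log n) / 16) := by
          rw [hl]
          push_cast
          ring
      _ ≤ p * (c' * (l : ℝ) ^ r / 16) := by gcongr p * (?_ / 16)
      _ = p * d * l := by rw [mul_assoc (p : ℝ), hdl]; ring
  · exact mul_self_mul_exp_neg_lt_one hn

theorem exists_f_le_mul_upperRate (hne : H ≠ ⊥) (hc : 0 ≤ c) (hc' : 0 < c') (hr1 : 1 < r)
    (hr2 : r < 2) (hex : ∀ l : ℕ, (extremalNumber l H : ℝ) ≤ c * (l : ℝ) ^ r)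
    (hex' : ∀ l : ℕ, N ≤ l → c' * (l : ℝ) ^ r ≤ extremalNumber l H) :
    ∃ C : ℝ, 0 < C ∧ ∀ n : ℕ, 2 ≤ n → (f n H : ℝ) ≤ C * upperRate r n := by
  obtain ⟨m, hm, hmc⟩ := exists_mul_rpow_neg_le (2 * c * 4 ^ r) (sub_pos.2 hr1)
    (show 0 < c' / 16 by positivity)
  obtain ⟨K, hK, hlogK⟩ := exists_log_le_mul_upperRate hr1 hr2
  have hL0 : 0 < 48 * m / c' := by positivity
  set L : ℝ := 1 + N + 3 * K + 48 * m / c'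
  have hL1 : 1 ≤ L := by linarith [N.cast_nonneg (α := ℝ)]
  have hLN : N ≤ L := by linarith
  have hLK : 3 * K ≤ L := by linarith [N.cast_nonneg (α := ℝ)]
  have hLc : 48 * m ≤ c' * L := by
    rw [← div_le_iff₀' hc']
    linarith [N.cast_nonneg (α := ℝ)]
  refine ⟨2 * L * (1 + m), by positivity, fun n hn => ?_⟩
  have hlog := half_le_log hn
  have hlogR : 3 * Real.log n ≤ L * upperRate r n := by
    have hR : 0 ≤ upperRate r n := upperRate_nonneg
    nlinarith [hlogK n hn, hLK]
  set p := ⌈L * upperRate r n⌉₊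
  have hRp : L * upperRate r n ≤ p := Nat.le_ceil _
  have hpR : (p : ℝ) ≤ 2 * (L * upperRate r n) := by
    linarith [Nat.ceil_lt_add_one (show 0 ≤ L * upperRate r n by linarith)]
  have hp : 0 < p := Nat.ceil_pos.2 (by linarith)
  have hNp : N ≤ p * n := by
    have hone := one_le_mul_upperRate (zero_lt_one.trans hr1) hn
    have : (N : ℝ) ≤ p * n := by nlinarith [hone, hRp, hLN]
    exact_mod_cast this
  have hpow : 48 * m * ((n : ℝ) ^ 2 * Real.log n) ≤ c' * (p * n : ℝ) ^ r :=
    calc 48 * m * ((n : ℝ) ^ 2 * Real.log n) ≤ c' * L * ((n : ℝ) ^ 2 * Real.log n) := by gcongr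
      _ = c' * (L * ((n : ℝ) ^ 2 * Real.log n)) := mul_assoc _ _ _
      _ ≤ c' * (p * n : ℝ) ^ r := by
          gcongr
          exact mul_sq_mul_log_le hr1.le hL1 (by omega) hRp
  have hfree := hasFreeNKGraph_of_log_le hne hc hc' (by linarith) hex hex' hm hmc hn hp hNp
    (hlogR.trans hRp) hpow
  calc (f n H : ℝ) ≤ (p + m * p : ℕ) := mod_cast f_le (by positivity) hfree
    _ = (1 + m) * p := by push_cast; ring
    _ ≤ (1 + m) * (2 * (L * upperRate r n)) := by gcongr
    _ = 2 * L * (1 + m) * upperRate r n := by ring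

theorem f_le_two_mul_upperRate_one [Fintype W] [DecidableRel H.Adj] (hdeg : 2 ≤ H.maxDegree)
    {n : ℕ} (hn : 2 ≤ n) : (f n H : ℝ) ≤ 2 * upperRate 1 n := by
  have hf : (f n H : ℝ) ≤ n := mod_cast f_le (by omega) (hasFreeNKGraph_self hdeg n)
  have hone : (2 : ℝ) / 1 - 1 = 1 := by norm_num
  rw [upperRate, hone, div_one, Real.rpow_one, Real.rpow_one]
  nlinarith [half_le_log hn]

end UpperBound

end SplitGraph

theorem corollary2 {W : Type*} [Fintype W] (H : SimpleGraph W) [DecidableRel H.Adj]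
    (hbip : H.IsBipartite) (hdeg : 2 ≤ H.maxDegree) (r : ℝ)
    (hex : (fun l : ℕ => (SimpleGraph.extremalNumber l H : ℝ)) =Θ[Filter.atTop]
      (fun l : ℕ => (l : ℝ) ^ r)) :
    ∃ C' C : ℝ, 0 < C' ∧ 0 < C ∧ ∀ n : ℕ, 2 ≤ n →
      C' * (n : ℝ) ^ (2 / r - 1) ≤ (SplitGraph.f n H : ℝ) ∧
      (SplitGraph.f n H : ℝ) ≤ C * (n : ℝ) ^ (2 / r - 1) * Real.log n ^ (1 / r) := by
  have hne : H ≠ ⊥ := mt SimpleGraph.maxDegree_eq_zero_iff.2 (by omega)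
  obtain ⟨c, hc, hle⟩ := SplitGraph.exists_forall_extremalNumber_le hex.isBigO
  obtain ⟨c', hc', N, hge⟩ := SplitGraph.exists_forall_ge_le_extremalNumber hex.isBigO_symm
  have hr1 : 1 ≤ r := SplitGraph.one_le_of_extremalNumber_le hdeg hle
  have hr2 : r < 2 := SplitGraph.lt_of_natCast_rpow_isLittleO
    (hex.isBigO_symm.trans_isLittleO (SplitGraph.isLittleO_extremalNumber_sq hbip))
  obtain ⟨C, hC, hupper⟩ :
      ∃ C : ℝ, 0 < C ∧ ∀ n : ℕ, 2 ≤ n → (SplitGraph.f n H : ℝ) ≤ C * SplitGraph.upperRate r n := by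
    rcases hr1.eq_or_lt with rfl | hr1
    · exact ⟨2, two_pos, fun n hn => SplitGraph.f_le_two_mul_upperRate_one hdeg hn⟩
    · exact SplitGraph.exists_f_le_mul_upperRate hne hc.le hc' hr1 hr2 hle hge
  refine ⟨(1 / (4 * c)) ^ (1 / r), C, by positivity, hC, fun n hn => ⟨?_, ?_⟩⟩
  · exact SplitGraph.le_f_of_extremalNumber_le hc (by linarith) hle hn (by omega)
      (SplitGraph.hasFreeNKGraph_self hdeg n)
  · rw [mul_assoc]
    exact hupper n hn
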